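/- Let $V$ and $W$ be real normed spaces such that $\min\{\dim V,\dim W\}<\infty$, where $\dim$ is the algebraic (Hamel) dimension over $\mathbb R$. For a mapping $f\colon V\to W$ (no continuity assumed), let $$\operatorname{dis} f=\sup_{x,x'\in V}\Bigl|\,\|f(x)-f(x')\|-\|x-x'\|\,\Bigr|\in[0,\infty]$$ be its distortion. If there is a mapping $f\colon V\to W$ with $\operatorname{dis} f<\infty$, then $\dim V\le\dim W$. The same holds if $f$ is a multivalued mapping, that is, $f$ assigns to every $x\in V$ a nonempty set $f(x)\subseteq W$, where in the definition of $\operatorname{dis} f$ the supremum of $\bigl|\,\|y-y'\|-\|x-x'\|\,\bigr|$ is taken over all $x,x'\in V$, $y\in f(x)$ and $y'\in f(x')$. -/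

import Mathlib

open scoped ENNReal

universe u v

/-- The distortion of a mapping `f : X → Y` of metric spaces, as an extended nonnegative number:
the supremum over `x, x'` of `| |f(x)f(x')| - |xx'| |`. -/
noncomputable def distortion {X Y : Type*} [MetricSpace X] [MetricSpace Y] (f : X → Y) : ℝ≥0∞ :=
  ⨆ (x : X) (x' : X), ENNReal.ofReal |dist (f x) (f x') - dist x x'|

/-- The distortion of a multivalued mapping `F` from `X` to `Y`: in the supremum, the images of
`x` and `x'` are arbitrary points of the sets `F x` and `F x'`. -/
noncomputable def multiDistortion {X Y : Type*} [MetricSpace X] [MetricSpace Y]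
    (F : X → Set Y) : ℝ≥0∞ :=
  ⨆ (x : X) (x' : X) (y ∈ F x) (y' ∈ F x'), ENNReal.ofReal |dist y y' - dist x x'|

/-- A quasi-isometric embedding of `ℝⁿ` into `ℝᵐ` forces `n ≤ m`. -/
theorem le_of_quasiIsometricEmbedding_pi {n m : ℕ} (g : (Fin n → ℝ) → (Fin m → ℝ))
    {a b A B : ℝ} (ha : 0 < a) (hA : 0 ≤ A) (hB : 0 ≤ B)
    (hlow : ∀ x y, a * dist x y - b ≤ dist (g x) (g y))
    (hupp : ∀ x y, dist (g x) (g y) ≤ A * dist x y + B) : n ≤ m := by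
  by_contra! hmn
  obtain ⟨s, hs⟩ : ∃ s : ℕ, (1 + b) / a ≤ s := exists_nat_ge _
  have hs' : 1 ≤ a * (s : ℝ) - b := by
    rw [div_le_iff₀ ha] at hs
    linarith
  obtain ⟨K, hK⟩ : ∃ K : ℕ, A * s + B + ‖g 0‖ + 1 ≤ K := exists_nat_ge _
  let p (N : ℕ) (k : Fin n → Fin N) : Fin n → ℝ := fun i => (s : ℝ) * ((k i : ℕ) : ℝ)
  let q (N : ℕ) (k : Fin n → Fin N) : Fin m → ℤ := fun j => ⌊g (p N k) j⌋
  have hp0 (N : ℕ) (k : Fin n → Fin N) : dist (p N k) 0 ≤ s * N := by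
    rw [dist_pi_le_iff (by positivity)]
    intro i
    have : ((k i : ℕ) : ℝ) ≤ N := by exact_mod_cast (k i).2.le
    simp only [p, Pi.zero_apply, dist_zero_right, Real.norm_eq_abs]
    rw [abs_of_nonneg (by positivity)]
    gcongr
  have hinj (N : ℕ) : Function.Injective (q N) := by
    intro k l hkl
    by_contra hne
    obtain ⟨i, hi⟩ := Function.ne_iff.1 hne
    have hi' : (1 : ℝ) ≤ |((k i : ℕ) : ℝ) - ((l i : ℕ) : ℝ)| := by
      have h1 : ((k i : ℕ) : ℤ) - ((l i : ℕ) : ℤ) ≠ 0 := by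
        have := Fin.val_ne_of_ne hi
        omega
      exact_mod_cast Int.one_le_abs h1
    have hd : (s : ℝ) ≤ dist (p N k) (p N l) := by
      refine le_trans ?_ (dist_le_pi_dist _ _ i)
      simp only [p, Real.dist_eq]
      rw [← mul_sub, abs_mul, Nat.abs_cast]
      exact le_mul_of_one_le_right (by positivity) hi'
    have hlt : dist (g (p N k)) (g (p N l)) < 1 := by
      rw [dist_pi_lt_iff one_pos]
      intro j
      exact Int.abs_sub_lt_one_of_floor_eq_floor (congrFun hkl j)
    have h2 := hlow (p N k) (p N l)
    have h3 : a * s ≤ a * dist (p N k) (p N l) := by gcongr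
    linarith
  have hmem (N : ℕ) (hN : 1 ≤ N) (k : Fin n → Fin N) :
      q N k ∈ Fintype.piFinset fun _ : Fin m => Finset.Ico (-(K * N : ℤ)) (K * N) := by
    rw [Fintype.mem_piFinset]
    intro j
    have hN' : (1 : ℝ) ≤ N := by exact_mod_cast hN
    have h1 : |g (p N k) j| + 1 ≤ K * N := by
      have h2 := norm_le_pi_norm (g (p N k)) j
      rw [Real.norm_eq_abs] at h2
      have h3 : ‖g (p N k)‖ ≤ dist (g (p N k)) (g 0) + ‖g 0‖ := by
        rw [dist_eq_norm]
        exact norm_le_norm_sub_add _ _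
      have h4 := hupp (p N k) 0
      have h5 : A * dist (p N k) 0 ≤ A * (s * N) := mul_le_mul_of_nonneg_left (hp0 N k) hA
      have h6 : (A * s + B + ‖g 0‖ + 1) * N ≤ K * N := by gcongr
      have h7 : B + ‖g 0‖ + 1 ≤ (B + ‖g 0‖ + 1) * N :=
        le_mul_of_one_le_right (by positivity) hN'
      linarith
    have h8 := abs_le.1 (le_sub_iff_add_le.2 h1)
    rw [Finset.mem_Ico]
    refine ⟨Int.le_floor.2 ?_, Int.floor_lt.2 ?_⟩ <;> push_cast <;> linarith [h8.1, h8.2]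
  have hcount (N : ℕ) (hN : 1 ≤ N) : N ^ n ≤ (2 * K * N) ^ m := by
    have h := Finset.card_le_card_of_injOn (s := Finset.univ) (q N) (fun k _ => hmem N hN k)
      (hinj N).injOn
    have h1 : (K * N + K * N : ℤ).toNat = 2 * K * N := by
      rw [← two_mul, ← mul_assoc]
      exact_mod_cast Int.toNat_natCast (2 * K * N)
    simpa [Fintype.card_piFinset, h1] using h
  have hN : 1 ≤ (2 * K) ^ m + 1 := by omega
  generalize hM : (2 * K) ^ m + 1 = M at hN
  have h1 : M ^ (m + 1) ≤ (2 * K) ^ m * M ^ m :=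
    ((Nat.pow_le_pow_right hN hmn).trans (hcount M hN)).trans_eq (mul_pow _ _ _)
  rw [pow_succ'] at h1
  have h2 := Nat.le_of_mul_le_mul_right h1 (Nat.pow_pos hN)
  omega

theorem abs_dist_sub_dist_le_distortion {X Y : Type*} [MetricSpace X] [MetricSpace Y] {f : X → Y}
    (hf : distortion f < ∞) (x x' : X) :
    |dist (f x) (f x') - dist x x'| ≤ (distortion f).toReal := by
  rw [← ENNReal.ofReal_le_iff_le_toReal hf.ne]
  exact le_iSup₂ (f := fun x x' : X => ENNReal.ofReal |dist (f x) (f x') - dist x x'|) x x'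

theorem distortion_le_multiDistortion {X Y : Type*} [MetricSpace X] [MetricSpace Y] {f : X → Y}
    {F : X → Set Y} (h : ∀ x, f x ∈ F x) : distortion f ≤ multiDistortion F := by
  refine iSup₂_mono fun x x' => ?_
  exact le_iSup₂_of_le (f x) (h x) (le_iSup₂_of_le (f x') (h x') le_rfl)

/-- A mapping of finite distortion into a finite-dimensional normed space does not lower the
dimension. -/
theorem le_finrank_of_distortion_lt_top {V W : Type*}
    [NormedAddCommGroup V] [NormedSpace ℝ V] [NormedAddCommGroup W] [NormedSpace ℝ W]
    [FiniteDimensional ℝ W] {f : V → W} (hf : distortion f < ∞) {n : ℕ}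
    (hn : (n : Cardinal) ≤ Module.rank ℝ V) : n ≤ Module.finrank ℝ W := by
  obtain ⟨T, hT⟩ := Module.le_rank_iff_exists_linearMap.1 hn
  obtain ⟨K, hK, hKT⟩ := T.exists_antilipschitzWith (LinearMap.ker_eq_bot.2 hT)
  let T' : (Fin n → ℝ) →L[ℝ] V := LinearMap.toContinuousLinearMap T
  let e : W ≃L[ℝ] (Fin (Module.finrank ℝ W) → ℝ) :=
    ContinuousLinearEquiv.ofFinrankEq (by simp)
  let e' : W →L[ℝ] (Fin (Module.finrank ℝ W) → ℝ) := e.toContinuousLinearMap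
  obtain ⟨L, hL, heL⟩ : ∃ L : NNReal, 0 < L ∧ AntilipschitzWith L e :=
    e.toLinearMap.exists_antilipschitzWith (LinearMap.ker_eq_bot.2 e.injective)
  have hK' : (0 : ℝ) < K := hK
  have hL' : (0 : ℝ) < L := hL
  set D := (distortion f).toReal
  have hD : 0 ≤ D := ENNReal.toReal_nonneg
  refine le_of_quasiIsometricEmbedding_pi (fun x => e (f (T x)))
    (a := (L : ℝ)⁻¹ * (K : ℝ)⁻¹) (b := (L : ℝ)⁻¹ * D)
    (A := ‖e'‖ * ‖T'‖) (B := ‖e'‖ * D)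
    (by positivity) (by positivity) (by positivity) (fun x y => ?_) (fun x y => ?_)
  · have h1 := heL.le_mul_dist (f (T x)) (f (T y))
    have h2 := hKT.le_mul_dist x y
    have h3 := (abs_le.1 (abs_dist_sub_dist_le_distortion hf (T x) (T y))).1
    rw [mul_assoc, ← mul_sub, inv_mul_le_iff₀ hL']
    have h4 : (K : ℝ)⁻¹ * dist x y ≤ dist (T x) (T y) := (inv_mul_le_iff₀ hK').2 h2
    linarith
  · have h1 : dist (e (f (T x))) (e (f (T y))) ≤ ‖e'‖ * dist (f (T x)) (f (T y)) :=
      e'.dist_le_opNorm _ _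
    have h2 : dist (T x) (T y) ≤ ‖T'‖ * dist x y := T'.dist_le_opNorm x y
    have h3 := (abs_le.1 (abs_dist_sub_dist_le_distortion hf (T x) (T y))).2
    rw [mul_assoc, ← mul_add]
    refine h1.trans (mul_le_mul_of_nonneg_left ?_ (norm_nonneg _))
    linarith

theorem lift_rank_le_of_distortion_lt_top {V : Type u} {W : Type v}
    [NormedAddCommGroup V] [NormedSpace ℝ V] [NormedAddCommGroup W] [NormedSpace ℝ W]
    (hdim : min (Cardinal.lift.{v} (Module.rank ℝ V)) (Cardinal.lift.{u} (Module.rank ℝ W))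
      < Cardinal.aleph0) {f : V → W} (hf : distortion f < ∞) :
    Cardinal.lift.{v} (Module.rank ℝ V) ≤ Cardinal.lift.{u} (Module.rank ℝ W) := by
  by_contra! hlt
  rw [min_eq_right hlt.le, Cardinal.lift_lt_aleph0] at hdim
  have : FiniteDimensional ℝ W := Module.rank_lt_aleph0_iff.1 hdim
  rw [← Module.finrank_eq_rank ℝ W, Cardinal.lift_natCast, Cardinal.nat_lt_lift_iff] at hlt
  have h1 : ((Module.finrank ℝ W + 1 : ℕ) : Cardinal) ≤ Module.rank ℝ V := by
    rw [Nat.cast_add_one, ← Cardinal.succ_natCast]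
    exact Order.succ_le_of_lt hlt
  have h2 := le_finrank_of_distortion_lt_top hf h1
  omega

theorem mainTheorem7 {V : Type u} {W : Type v}
    [NormedAddCommGroup V] [NormedSpace ℝ V]
    [NormedAddCommGroup W] [NormedSpace ℝ W]
    (hdim : min (Cardinal.lift.{v} (Module.rank ℝ V)) (Cardinal.lift.{u} (Module.rank ℝ W))
      < Cardinal.aleph0) :
    (∀ f : V → W, distortion f < ∞ →
      Cardinal.lift.{v} (Module.rank ℝ V) ≤ Cardinal.lift.{u} (Module.rank ℝ W)) ∧
    (∀ F : V → Set W, (∀ x : V, (F x).Nonempty) → multiDistortion F < ∞ →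
      Cardinal.lift.{v} (Module.rank ℝ V) ≤ Cardinal.lift.{u} (Module.rank ℝ W)) := by
  refine ⟨fun f hf => lift_rank_le_of_distortion_lt_top hdim hf, fun F hne hF => ?_⟩
  choose f hf using hne
  exact lift_rank_le_of_distortion_lt_top hdim ((distortion_le_multiDistortion hf).trans_lt hF)
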